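/- Let $n\ge 1$ and write $[n]=\{1,2,\dots,n\}$ (with $[0]=\emptyset$). Let $\mathcal S_n$ be the set of permutations of $[n]$ and $\mathcal C_n\subseteq\mathcal S_n$ the set of $n$-cycles, that is, of permutations consisting of one single cycle of length $n$ (for $n=1$ the identity is the only one). For $\pi\in\mathcal S_n$ let $$D(\pi)=\{i : 1\le i\le n-1,\ \pi(i)>\pi(i+1)\}$$ be its descent set. Fix $1\le m\le n$ and let $J=[n-1]\setminus\{m-1,m\}$. Then for every $I\subseteq J$, $$|\{\pi\in\mathcal C_n : D(\pi)\cap J=I\}|=|\{\sigma\in\mathcal S_n : \sigma(m)=1,\ D(\sigma)\cap J=I\}|.$$ -/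

import Mathlib

/-- The set of cyclic permutations (`n`-cycles) of an `n`-element set: the permutations that consist
of one single cycle of length `n`, i.e. any two elements lie on the same cycle.
For `n = 1` the identity is a `1`-cycle. -/
def cyclicPerms (n : ℕ) : Set (Equiv.Perm (Fin n)) :=
  {π | π.IsCycleOn Set.univ}

/-- The descent set `D(π) = {i : 1 ≤ i ≤ n - 1, π(i) > π(i+1)}`, with positions numbered from `1`.
The element `j : Fin n` stands for `j + 1 ∈ {1, …, n}`, so that position `i` is the index `i - 1`
and position `i + 1` is the index `i`. -/
def descentSet {n : ℕ} (π : Equiv.Perm (Fin n)) : Finset ℕ :=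
  {i ∈ Finset.Icc 1 (n - 1) | ∃ a b : Fin n, (a : ℕ) + 1 = i ∧ (b : ℕ) = i ∧ π b < π a}

/-!
By inclusion-exclusion it suffices to count, for every set `C` of positions containing `m - 1` and
`m`, the permutations with `D(π) ⊆ C`. Cut `[n]` into blocks after each position in `C` and let `f`
map an element to the index of its block: then `D(π) ⊆ C` says that `π` is increasing on the fibers
of `f`, and `{m}` is a fiber.

Both families are in bijection with the words `f ∘ s⁻¹`, where `s` runs over the permutations with a
prescribed value at `m`. A permutation `σ` that is increasing on the fibers of `f` is the stable
sort of the word `f ∘ σ⁻¹`. An `n`-cycle is `s⁻¹ ρ s` for a fixed `n`-cycle `ρ` and a unique `s`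
with the prescribed value at `m`; it is increasing on the fibers of `f` exactly when `s` sorts the
positions of the word `w = f ∘ s⁻¹` by their itineraries `w(i), w(ρ i), w(ρ² i), …` in lexicographic
order. These itineraries are distinct, because the letter of the block `{m}` occurs only once.
-/

open Function Equiv.Perm

theorem ncard_setOf_comp_of_bijOn {α β : Type*} {s : Set α} {t : Set β} {g : α → β}
    (hg : Set.BijOn g s t) (Q : β → Prop) :
    {a | a ∈ s ∧ Q (g a)}.ncard = {b | b ∈ t ∧ Q b}.ncard := by
  refine Set.BijOn.ncard_eq (f := g) ⟨fun a ha => ⟨hg.mapsTo ha.1, ha.2⟩,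
    hg.injOn.mono (Set.sep_subset _ _), ?_⟩
  rintro b ⟨hb, hQ⟩
  obtain ⟨a, ha, rfl⟩ := hg.surjOn hb
  exact ⟨a, ⟨ha, hQ⟩, rfl⟩

section Inversion

variable {α β γ : Type*} [PartialOrder γ] [LocallyFiniteOrderBot γ] {s : Set α} {t : Set β}

theorem ncard_setOf_le_eq_sum_ncard_setOf_eq (hs : s.Finite) (g : α → γ) (x : γ) :
    {a | a ∈ s ∧ g a ≤ x}.ncard = ∑ y ∈ Finset.Iic x, {a | a ∈ s ∧ g a = y}.ncard := by
  classical
  lift s to Finset α using hs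
  have ncard_eq (P : α → Prop) : {a | a ∈ (s : Set α) ∧ P a}.ncard = (s.filter P).card := by
    rw [← Set.ncard_coe_finset, Finset.coe_filter]
    rfl
  simp only [ncard_eq]
  rw [Finset.card_eq_sum_card_fiberwise (f := g) (t := Finset.Iic x) fun a ha => by simp_all]
  refine Finset.sum_congr rfl fun y hy => ?_
  rw [Finset.filter_filter]
  exact congrArg _ (Finset.filter_congr fun a _ =>
    and_iff_right_of_imp fun h => h.trans_le (Finset.mem_Iic.1 hy))

theorem ncard_setOf_eq_of_ncard_setOf_le (hs : s.Finite) (ht : t.Finite)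
    {g : α → γ} {h : β → γ}
    (hle : ∀ x, {a | a ∈ s ∧ g a ≤ x}.ncard = {b | b ∈ t ∧ h b ≤ x}.ncard) (x : γ) :
    {a | a ∈ s ∧ g a = x}.ncard = {b | b ∈ t ∧ h b = x}.ncard := by
  have hcard : StrictMono fun y : γ => (Finset.Iic y).card := fun y z hyz =>
    Finset.card_lt_card (Finset.Iic_ssubset_Iic.2 hyz)
  have := hcard.wellFoundedLT
  induction x using WellFoundedLT.induction with
  | ind x ih =>
    have hsum := hle x
    rw [ncard_setOf_le_eq_sum_ncard_setOf_eq hs, ncard_setOf_le_eq_sum_ncard_setOf_eq ht,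
      Finset.Iic_eq_cons_Iio, Finset.sum_cons, Finset.sum_cons,
      Finset.sum_congr rfl fun y hy => ih y (Finset.mem_Iio.1 hy)] at hsum
    exact Nat.add_right_cancel hsum

end Inversion

section Fibers

/-- The map `T` is strictly increasing on each fiber of `f`. With `f` the block index of a partition
of `[n]` into intervals, this bounds the descent set of `T`. -/
def StrictMonoOnFibers {ι α β : Type*} [Preorder ι] [Preorder β] (f : ι → α) (T : ι → β) : Prop :=
  ∀ ⦃a b⦄, a < b → f a = f b → T a < T b

theorem strictMonoOnFibers_iff_covBy {ι α β : Type*} [LinearOrder ι] [SuccOrder ι]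
    [IsSuccArchimedean ι] [PartialOrder α] [Preorder β] {f : ι → α} {T : ι → β}
    (hf : Monotone f) :
    StrictMonoOnFibers f T ↔ ∀ ⦃a b⦄, a ⋖ b → f a = f b → T a < T b := by
  refine ⟨fun h a b hab => h hab.lt, fun h a b hab hfab => ?_⟩
  have hT : StrictMonoOn T (f ⁻¹' {f b}) :=
    strictMonoOn_of_lt_succ (Set.ordConnected_singleton.preimage_mono hf) fun c hc hcb hcb' =>
      h (Order.covBy_succ_of_not_isMax hc) (hcb.trans hcb'.symm)
  exact hT hfab rfl hab

end Fibers

section Itinerary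

variable {ι α : Type*} {f : ι → α} {T : ι → ι}

/-- The itinerary of `a` under the map `T`: the sequence of the labels `f a, f (T a), f (T² a), …`
read along the orbit of `a`. Itineraries are compared lexicographically. -/
def itinerary (f : ι → α) (T : ι → ι) (a : ι) : Lex (ℕ → α) :=
  toLex fun k => f (T^[k] a)

theorem itinerary_comp_of_semiconj {κ : Type*} {e : κ → ι} {S : κ → κ} (h : Semiconj e S T) :
    itinerary f T ∘ e = itinerary (f ∘ e) S := by
  funext a
  exact congrArg toLex (funext fun k => congrArg f ((h.iterate_right k).eq a).symm)

theorem itinerary_injective (hT : Injective T) {p : ι} (hp : ∀ a, f a = f p → a = p)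
    (hreach : ∀ a, ∃ k, T^[k] a = p) : Injective (itinerary f T) := by
  intro a b hab
  obtain ⟨k, hk⟩ := hreach a
  have hfk : f (T^[k] a) = f (T^[k] b) := congrFun hab k
  rw [hk] at hfk
  exact hT.iterate k (hk.trans (hp _ hfk.symm).symm)

theorem le_of_itinerary_le [LinearOrder α] {a b : ι}
    (h : itinerary f T a ≤ itinerary f T b) : f a ≤ f b :=
  Pi.apply_le_of_toLex (x := fun k => f (T^[k] a)) (y := fun k => f (T^[k] b)) (i := 0) h
    fun _ hj => absurd hj (Nat.not_lt_zero _)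

theorem itinerary_map_lt_itinerary_map [Preorder α] {a b : ι} (hab : f a = f b)
    (h : itinerary f T a < itinerary f T b) :
    itinerary f T (T a) < itinerary f T (T b) := by
  obtain ⟨k, heq, hlt⟩ := h
  cases k with
  | zero => exact absurd hab (ne_of_lt hlt)
  | succ k => exact ⟨k, fun l hl => heq (l + 1) (Nat.succ_lt_succ hl), hlt⟩

theorem StrictMonoOnFibers.iterate_lt_iterate [Preorder ι] (hT : StrictMonoOnFibers f T) {a b : ι}
    (hab : a < b) {k : ℕ} (h : ∀ l < k, f (T^[l] a) = f (T^[l] b)) : T^[k] a < T^[k] b := by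
  induction k with
  | zero => exact hab
  | succ k ih =>
    rw [iterate_succ_apply', iterate_succ_apply']
    exact hT (ih fun l hl => h l (hl.trans k.lt_succ_self)) (h k k.lt_succ_self)

theorem StrictMonoOnFibers.monotone_itinerary [PartialOrder ι] [LinearOrder α] (hf : Monotone f)
    (hT : StrictMonoOnFibers f T) : Monotone (itinerary f T) := by
  refine monotone_iff_forall_lt.2 fun a b hab => le_of_not_gt fun ⟨k, heq, hlt⟩ => ?_
  exact hlt.not_ge (hf (hT.iterate_lt_iterate hab fun l hl => (heq l hl).symm).le)

theorem strictMonoOnFibers_of_strictMono_itinerary [LinearOrder ι] [PartialOrder α]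
    (h : StrictMono (itinerary f T)) : StrictMonoOnFibers f T :=
  fun _ _ hab hfab => h.lt_iff_lt.1 (itinerary_map_lt_itinerary_map hfab (h hab))

theorem strictMono_itinerary_iff [LinearOrder ι] [LinearOrder α] (hf : Monotone f)
    (hinj : Injective (itinerary f T)) :
    StrictMono (itinerary f T) ↔ StrictMonoOnFibers f T :=
  ⟨strictMonoOnFibers_of_strictMono_itinerary,
    fun hT => (hT.monotone_itinerary hf).strictMono_of_injective hinj⟩

end Itinerary

section FullCycles

variable {X : Type*} [Finite X] {π ρ : Equiv.Perm X}

theorem isConj_of_isCycleOn_univ (hπ : π.IsCycleOn Set.univ) (hρ : ρ.IsCycleOn Set.univ) :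
    IsConj π ρ := by
  classical
  have := Fintype.ofFinite X
  rcases subsingleton_or_nontrivial X with hX | hX
  · rw [Subsingleton.elim π ρ]
  · have isCycle {τ : Equiv.Perm X} (hτ : τ.IsCycleOn Set.univ) : τ.IsCycle :=
      isCycle_iff_exists_isCycleOn.2 ⟨_, Set.nontrivial_univ, hτ, fun _ _ => Set.mem_univ _⟩
    have support_eq {τ : Equiv.Perm X} (hτ : τ.IsCycleOn Set.univ) : τ.support = Finset.univ :=
      Finset.eq_univ_iff_forall.2 fun a =>
        mem_support.2 (hτ.apply_ne Set.nontrivial_univ (Set.mem_univ a))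
    exact (isCycle hπ).isConj (isCycle hρ) (by rw [support_eq hπ, support_eq hρ])

theorem bijOn_conj_isCycleOn_univ (hρ : ρ.IsCycleOn Set.univ) (p q : X) :
    Set.BijOn (fun s : Equiv.Perm X => s⁻¹ * ρ * s) {s | s p = q} {π | π.IsCycleOn Set.univ} := by
  refine ⟨fun s _ => ?_, fun s hs t ht hst => ?_, fun π hπ => ?_⟩
  · simpa using hρ.conj (g := s⁻¹)
  · have hcomm : Commute (t * s⁻¹) ρ := by
      have hst' : s⁻¹ * ρ * s = t⁻¹ * ρ * t := hst
      calc t * s⁻¹ * ρ = t * (s⁻¹ * ρ * s) * s⁻¹ := by group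
        _ = ρ * (t * s⁻¹) := by rw [hst']; group
    have hfix : (t * s⁻¹) q = q := by
      rw [mul_apply, inv_eq_iff_eq.2 hs.symm, ht.out]
    have hone : t * s⁻¹ = 1 := by
      ext a
      obtain ⟨k, rfl⟩ := hρ.2 (Set.mem_univ q) (Set.mem_univ a)
      rw [← mul_apply, (hcomm.zpow_right k).eq, mul_apply, hfix, one_apply]
    exact (mul_inv_eq_one.1 hone).symm
  · obtain ⟨c, hc⟩ := isConj_iff.1 (isConj_of_isCycleOn_univ hπ hρ)
    obtain ⟨k, hk⟩ := hρ.2 (Set.mem_univ (c p)) (Set.mem_univ q)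
    refine ⟨ρ ^ k * c, hk, ?_⟩
    calc (ρ ^ k * c)⁻¹ * ρ * (ρ ^ k * c) = c⁻¹ * ρ * c := by group
      _ = π := by rw [← hc]; group

theorem isCycleOn_finRotate_univ (n : ℕ) : (finRotate n).IsCycleOn Set.univ := by
  match n with
  | 0 | 1 => exact isCycleOn_of_subsingleton _ _
  | n + 2 =>
    convert (isCycle_finRotate (n := n)).isCycleOn
    exact (Set.eq_univ_of_forall fun a =>
      mem_support.1 (support_finRotate ▸ Finset.mem_univ a)).symm

end FullCycles

section Sorting

variable {n : ℕ} {α β : Type*} [LinearOrder α] [LinearOrder β] {f : Fin n → α} {p : Fin n}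

theorem eq_sort_comp_symm_iff_strictMonoOnFibers (hf : Monotone f) (σ : Equiv.Perm (Fin n)) :
    σ = Tuple.sort (f ∘ σ.symm) ↔ StrictMonoOnFibers f σ := by
  simp [Tuple.eq_sort_iff, comp_assoc, hf, StrictMonoOnFibers]

theorem eq_sort_iff_strictMono_of_injective {v : Fin n → β} (hv : Injective v)
    (s : Equiv.Perm (Fin n)) : s = Tuple.sort v ↔ StrictMono (v ∘ s) := by
  refine Tuple.eq_sort_iff.trans ⟨fun h => h.1.strictMono_of_injective (hv.comp s.injective),
    fun h => ⟨h.monotone, fun i j hij hv_eq => absurd hv_eq (h hij).ne⟩⟩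

theorem bijOn_comp_symm_setOf_eq_sort (hf : Monotone f) (hp : ∀ a, f a = f p → a = p) (q : Fin n)
    {key : (Fin n → α) → Fin n → β} (hkey : ∀ w i j, key w i ≤ key w j → w i ≤ w j) :
    Set.BijOn (fun s : Equiv.Perm (Fin n) => f ∘ s.symm)
      {s | s p = q ∧ s = Tuple.sort (key (f ∘ s.symm))}
      ((fun s : Equiv.Perm (Fin n) => f ∘ s.symm) '' {s | s p = q}) := by
  refine ⟨fun s hs => ⟨s, hs.1, rfl⟩, fun s hs t ht hst => ?_, ?_⟩
  · rw [hs.2, ht.2]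
    exact congrArg (fun w => Tuple.sort (key w)) hst
  · rintro _ ⟨t, ht, rfl⟩
    set w := f ∘ t.symm with hw
    set s := Tuple.sort (key w)
    have hws : w ∘ s = f := by
      have hwt : w ∘ t = f := by simp [hw, comp_assoc]
      have hws_mono : Monotone (w ∘ s) :=
        fun i j hij => hkey w _ _ (Tuple.monotone_sort (key w) hij)
      exact (Tuple.unique_monotone hws_mono (hwt.symm ▸ hf)).trans hwt
    have hfs : f ∘ s.symm = w := by simp [← hws, comp_assoc]
    have hsp : s.symm q = p := hp _ <| by
      rw [← comp_apply (f := f), hfs, hw, comp_apply, ← ht.out, Equiv.symm_apply_apply]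
    exact ⟨s, ⟨(s.symm_apply_eq.1 hsp).symm, by rw [hfs]⟩, hfs⟩

theorem strictMonoOnFibers_conj_iff (hf : Monotone f) (hp : ∀ a, f a = f p → a = p)
    {ρ : Equiv.Perm (Fin n)} (hρ : ρ.IsCycleOn Set.univ) (s : Equiv.Perm (Fin n)) :
    StrictMonoOnFibers f (s⁻¹ * ρ * s : Equiv.Perm (Fin n)) ↔
      s = Tuple.sort (itinerary (f ∘ s.symm) ρ) := by
  set w := f ∘ s.symm with hw
  have hinj : Injective (itinerary w ρ) := by
    refine itinerary_injective ρ.injective (p := s p) (fun i hi => ?_) fun i => ?_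
    · exact (s.symm_apply_eq.1 (hp _ (by simpa [hw] using hi)))
    · obtain ⟨k, hk⟩ := hρ.exists_pow_eq' Set.finite_univ (Set.mem_univ i) (Set.mem_univ (s p))
      exact ⟨k, by rwa [iterate_eq_pow]⟩
  have hsemi : Semiconj s (s⁻¹ * ρ * s : Equiv.Perm (Fin n)) ρ := fun a => by simp
  have hconj : itinerary w ρ ∘ s = itinerary f (s⁻¹ * ρ * s : Equiv.Perm (Fin n)) := by
    rw [itinerary_comp_of_semiconj hsemi, hw, comp_assoc, Equiv.symm_comp_self, comp_id]
  rw [eq_sort_iff_strictMono_of_injective hinj, hconj,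
    strictMono_itinerary_iff hf (hconj ▸ hinj.comp s.injective)]

theorem ncard_isCycleOn_univ_strictMonoOnFibers (hf : Monotone f) (hp : ∀ a, f a = f p → a = p)
    (q : Fin n) :
    {π : Equiv.Perm (Fin n) | π.IsCycleOn Set.univ ∧ StrictMonoOnFibers f π}.ncard =
      {σ : Equiv.Perm (Fin n) | σ p = q ∧ StrictMonoOnFibers f σ}.ncard := by
  have hρ := isCycleOn_finRotate_univ n
  calc {π : Equiv.Perm (Fin n) | π.IsCycleOn Set.univ ∧ StrictMonoOnFibers f π}.ncard
    _ = {s | s p = q ∧ s = Tuple.sort (itinerary (f ∘ s.symm) (finRotate n))}.ncard := by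
      simp only [← strictMonoOnFibers_conj_iff hf hp hρ]
      exact (ncard_setOf_comp_of_bijOn (bijOn_conj_isCycleOn_univ hρ p q) _).symm
    _ = ((fun s : Equiv.Perm (Fin n) => f ∘ s.symm) '' {s | s p = q}).ncard :=
      (bijOn_comp_symm_setOf_eq_sort hf hp q (key := fun w => itinerary w (finRotate n))
        fun _ _ _ => le_of_itinerary_le).ncard_eq
    _ = {σ | σ p = q ∧ σ = Tuple.sort (f ∘ σ.symm)}.ncard :=
      (bijOn_comp_symm_setOf_eq_sort hf hp q (key := id) fun _ _ _ => id).ncard_eq.symm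
    _ = {σ : Equiv.Perm (Fin n) | σ p = q ∧ StrictMonoOnFibers f σ}.ncard := by
      simp only [eq_sort_comp_symm_iff_strictMonoOnFibers hf]

end Sorting

section Descents

variable {n : ℕ} {P : ℕ → Prop} [DecidablePred P]

/-- The index of the block containing `a` when `Fin n` is cut before each element satisfying `P`,
that is, after each position satisfying `P` when positions are numbered from `1`. -/
def blockIndex (P : ℕ → Prop) [DecidablePred P] (a : Fin n) : ℕ :=
  Nat.count P (a + 1)

theorem blockIndex_monotone : Monotone (blockIndex P : Fin n → ℕ) :=
  fun _ _ hab => Nat.count_monotone P (Nat.succ_le_succ hab)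

theorem blockIndex_lt_blockIndex {a b : Fin n} {c : ℕ} (hc : P c) (hac : a < c) (hcb : c ≤ b) :
    blockIndex P a < blockIndex P b :=
  (Nat.count_monotone P hac).trans_lt (Nat.count_strict_mono hc (Nat.lt_succ_of_le hcb))

theorem blockIndex_eq_iff_of_covBy {a b : Fin n} (hab : a ⋖ b) :
    blockIndex P a = blockIndex P b ↔ ¬ P b := by
  have hval : (a : ℕ) + 1 = b := by simpa using hab
  rw [blockIndex, blockIndex, hval, eq_comm, Nat.count_succ_eq_count_iff]

theorem eq_of_blockIndex_eq {p a : Fin n} (hp : P p) (hp' : P (p + 1))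
    (h : blockIndex P a = blockIndex P p) : a = p := by
  rcases lt_trichotomy a p with hlt | heq | hgt
  · exact absurd h (blockIndex_lt_blockIndex hp hlt le_rfl).ne
  · exact heq
  · exact absurd h (blockIndex_lt_blockIndex hp' (Nat.lt_succ_self p) hgt).ne'

theorem mem_descentSet_iff_exists_covBy {π : Equiv.Perm (Fin n)} {i : ℕ} :
    i ∈ descentSet π ↔ ∃ a b : Fin n, a ⋖ b ∧ (b : ℕ) = i ∧ π b < π a := by
  simp only [descentSet, Finset.mem_filter, Finset.mem_Icc, Fin.covBy_iff,
    Nat.covBy_iff_add_one_eq]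
  constructor
  · rintro ⟨-, a, b, ha, hb, hlt⟩
    exact ⟨a, b, ha.trans hb.symm, hb, hlt⟩
  · rintro ⟨a, b, hab, hb, hlt⟩
    exact ⟨by omega, a, b, hab.trans hb, hb, hlt⟩

theorem strictMonoOnFibers_blockIndex_iff (π : Equiv.Perm (Fin n)) :
    StrictMonoOnFibers (blockIndex P) π ↔ ∀ i ∈ descentSet π, P i := by
  rw [strictMonoOnFibers_iff_covBy blockIndex_monotone]
  simp only [mem_descentSet_iff_exists_covBy]
  constructor
  · rintro h _ ⟨a, b, hab, rfl, hlt⟩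
    by_contra hb
    exact hlt.not_gt (h hab ((blockIndex_eq_iff_of_covBy hab).2 hb))
  · intro h a b hab hblock
    have hb : ¬ P b := (blockIndex_eq_iff_of_covBy hab).1 hblock
    exact (π.injective.ne hab.ne).lt_of_le (not_lt.1 fun hlt => hb (h b ⟨a, b, hab, rfl, hlt⟩))

end Descents

theorem ncard_cyclicPerms_forall_mem_descentSet {n : ℕ} {P : ℕ → Prop} {p : Fin n} (hp : P p)
    (hp' : P (p + 1)) (q : Fin n) :
    {π : Equiv.Perm (Fin n) | π ∈ cyclicPerms n ∧ ∀ i ∈ descentSet π, P i}.ncard =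
      {σ : Equiv.Perm (Fin n) | σ p = q ∧ ∀ i ∈ descentSet σ, P i}.ncard := by
  classical
  simp only [← strictMonoOnFibers_blockIndex_iff]
  exact ncard_isCycleOn_univ_strictMonoOnFibers blockIndex_monotone
    (fun a => eq_of_blockIndex_eq hp hp') q

theorem corollary4_general {n : ℕ} (p q : Fin n) {J : Finset ℕ} (hp : (p : ℕ) ∉ J)
    (hp' : (p : ℕ) + 1 ∉ J) (I : Finset ℕ) :
    {π : Equiv.Perm (Fin n) | π ∈ cyclicPerms n ∧ descentSet π ∩ J = I}.ncard =
      {σ : Equiv.Perm (Fin n) | σ p = q ∧ descentSet σ ∩ J = I}.ncard := by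
  refine ncard_setOf_eq_of_ncard_setOf_le (s := cyclicPerms n)
    (t := {σ : Equiv.Perm (Fin n) | σ p = q}) (Set.toFinite _) (Set.toFinite _) (fun K => ?_) I
  have hsubset (π : Equiv.Perm (Fin n)) :
      descentSet π ∩ J ≤ K ↔ ∀ i ∈ descentSet π, i ∈ J → i ∈ K := by
    simp [Finset.subset_iff]
  simp only [hsubset]
  exact ncard_cyclicPerms_forall_mem_descentSet (absurd · hp) (absurd · hp') q

theorem corollary4 (n m : ℕ) (hm : 1 ≤ m) (hmn : m ≤ n) (J : Finset ℕ)
    (hJ : J = Finset.Icc 1 (n - 1) \ {m - 1, m}) (I : Finset ℕ) (hI : I ⊆ J) :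
    Set.ncard {π : Equiv.Perm (Fin n) | π ∈ cyclicPerms n ∧ descentSet π ∩ J = I} =
      Set.ncard {σ : Equiv.Perm (Fin n) |
        σ ⟨m - 1, by omega⟩ = ⟨0, by omega⟩ ∧ descentSet σ ∩ J = I} :=
  corollary4_general _ _ (by simp [hJ]) (by simp [hJ, Nat.sub_add_cancel hm]) I
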